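/- An instance of the fair multi-user dueling bandit problem with $D$ users and $K$ arms is a preference tensor $P\in[0,1]^{D\times K\times K}$, where $P_{d,i,j}$ is the probability that user $d$ prefers arm $i$ over arm $j$, with $P_{d,i,j}+P_{d,j,i}=1$ and $P_{d,i,i}=\tfrac12$, such that every user $d$ has a (necessarily unique) Condorcet winner, i.e. an arm $a^*_d$ with $P_{d,a^*_d,j}>\tfrac12$ for all $j\neq a^*_d$. The score of arm $i$ for user $d$ is $s_d(i)=2P_{d,i,a^*_d}$, and the Nash social welfare of a policy $\pi$ in the probability simplex $\Delta^K$ is $f(\pi)=\prod_{d=1}^D\sum_{a=1}^K\pi(a)s_d(a)$. In each round $t$ a (possibly randomized) online algorithm chooses two policies $\pi_t,\pi'_t\in\Delta^K$ as a function of its internal randomness and of the arms and feedback of the previous rounds; arms $a_t\sim\pi_t$ and $a'_t\sim\pi'_t$ are drawn independently, and the algorithm observes them together with a vector $y_t\in\{0,1\}^D$ whose entries are independent given $a_t,a'_t$, with $y_t[d]=1$ with probability $P_{d,a_t,a'_t}$. The expected regret over the horizon $T$ is $$\mathbb{E}[R_T]=\mathbb{E}\left[\sum_{t=1}^T\left(\max_{\pi\in\Delta^K}f(\pi)-\frac{f(\pi_t)+f(\pi'_t)}{2}\right)\right].$$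 **Theorem.** There is a universal constant $c>0$ such that for all integers $D,K\ge 4$, all $T\ge\min(K,D)$, and every online algorithm (which may know $D$, $K$ and $T$), there is an instance with $D$ users and $K$ arms on which $$\mathbb{E}[R_T]\ \ge\ c\,T^{2/3}\min(K,D)^{1/3}.$$ -/

import Mathlib

open MeasureTheory

namespace FairDueling

/-- An instance of the fair multi-user dueling bandit problem with `D` users and `K` arms:
a preference tensor with entries in `[0, 1]` and the reciprocal property, for which every user `d`
has a Condorcet winner, namely the arm `winner d`
(it is determined by the preferences, see `existsUnique_winner`). -/
structure Problem (D K : ℕ) where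
  /-- `pref d i j` is the probability that user `d` prefers arm `i` over arm `j`. -/
  pref : Fin D → Fin K → Fin K → ℝ
  pref_mem : ∀ d i j, pref d i j ∈ Set.Icc (0 : ℝ) 1
  pref_add_swap : ∀ d i j, pref d i j + pref d j i = 1
  pref_self : ∀ d i, pref d i i = 1 / 2
  /-- The Condorcet winner of each user. -/
  winner : Fin D → Fin K
  winner_spec : ∀ d j, j ≠ winner d → 1 / 2 < pref d (winner d) j

/-- A policy: a point of the probability simplex over the `K` arms. -/
abbrev Policy (K : ℕ) : Type := stdSimplex ℝ (Fin K)

/-- What is observed in one round: the two arms that were played, and the binary feedback vector,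
whose entry `d` says whether user `d` preferred the first arm over the second one. -/
abbrev Round (D K : ℕ) : Type := Fin K × Fin K × (Fin D → Bool)

namespace Problem

variable {D K : ℕ}

theorem existsUnique_winner (I : Problem D K) (d : Fin D) :
    ∃! a : Fin K, ∀ j, j ≠ a → 1 / 2 < I.pref d a j := by
  refine ⟨I.winner d, I.winner_spec d, fun a ha => ?_⟩
  by_contra hne
  have h1 := I.winner_spec d a hne
  have h2 := ha (I.winner d) (Ne.symm hne)
  have h3 := I.pref_add_swap d a (I.winner d)
  linarith

/-- The score of arm `i` for user `d`. -/
noncomputable def score (I : Problem D K) (d : Fin D) (i : Fin K) : ℝ :=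
  2 * I.pref d i (I.winner d)

/-- The Nash social welfare of a policy: the product over the users of their expected scores. -/
noncomputable def nsw (I : Problem D K) (π : Policy K) : ℝ :=
  ∏ d : Fin D, ∑ a : Fin K, (π : Fin K → ℝ) a * I.score d a

/-- The optimal Nash social welfare; it is attained, see `exists_optimal`. -/
noncomputable def optNsw (I : Problem D K) : ℝ := ⨆ π : Policy K, I.nsw π

theorem exists_optimal [NeZero K] (I : Problem D K) :
    ∃ πopt : Policy K, (∀ π : Policy K, I.nsw π ≤ I.nsw πopt) ∧ I.optNsw = I.nsw πopt := by
  have hne : Nonempty (Policy K) := ⟨⟨Pi.single 0 1, single_mem_stdSimplex ℝ 0⟩⟩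
  have hc : Continuous I.nsw := by
    unfold nsw
    exact continuous_finsetProd _ fun d _ => continuous_finsetSum _ fun a _ =>
      ((continuous_apply a).comp continuous_subtype_val).mul continuous_const
  have hcs : CompactSpace (Policy K) := isCompact_iff_compactSpace.mp (isCompact_stdSimplex _ _)
  obtain ⟨x, -, hx⟩ := isCompact_univ.exists_isMaxOn Set.univ_nonempty hc.continuousOn
  have hx' : ∀ π : Policy K, I.nsw π ≤ I.nsw x := fun π => hx (Set.mem_univ π)
  refine ⟨x, hx', le_antisymm (ciSup_le hx') (le_ciSup (f := I.nsw) ⟨I.nsw x, ?_⟩ x)⟩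
  rintro _ ⟨π, rfl⟩
  exact hx' π

/-- The probability that a round has the outcome `o` when the policies `p` and `q` are used:
the two arms are drawn independently from `p` and from `q`, and given these arms `i`, `j` the users
answer independently, user `d` in favour of `i` with probability `pref d i j`. -/
noncomputable def roundProb (I : Problem D K) (p q : Policy K) (o : Round D K) : ℝ :=
  (p : Fin K → ℝ) o.1 * (q : Fin K → ℝ) o.2.1 *
    ∏ d : Fin D, if o.2.2 d then I.pref d o.1 o.2.1 else 1 - I.pref d o.1 o.2.1

end Problem

/-- A (randomized) online algorithm with random seed in the probability space `(Ω, seedLaw)`.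
After `t` rounds it chooses the two policies of the next round as a function of the seed and of
everything that was observed in those rounds. -/
structure OnlineAlgorithm (D K : ℕ) (Ω : Type*) [MeasurableSpace Ω] where
  seedLaw : Measure Ω
  isProbabilityMeasure_seedLaw : IsProbabilityMeasure seedLaw
  policy₁ : (t : ℕ) → (Fin t → Round D K) → Ω → Policy K
  policy₂ : (t : ℕ) → (Fin t → Round D K) → Ω → Policy K
  measurable_policy₁ : ∀ t h, Measurable (policy₁ t h)
  measurable_policy₂ : ∀ t h, Measurable (policy₂ t h)

/-- The first `t` rounds of a sequence of `T` rounds, where `t < T`. -/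
def past {D K T : ℕ} (h : Fin T → Round D K) (t : Fin T) : Fin (t : ℕ) → Round D K :=
  fun s => h (Fin.castLE t.isLt.le s)

namespace OnlineAlgorithm

variable {D K : ℕ} {Ω : Type*} [MeasurableSpace Ω]

/-- The probability, given the seed `ω`, that the first `T` rounds on the instance `I` are `h`. -/
noncomputable def historyProb (A : OnlineAlgorithm D K Ω) (I : Problem D K) {T : ℕ}
    (ω : Ω) (h : Fin T → Round D K) : ℝ :=
  ∏ t : Fin T, I.roundProb (A.policy₁ t (past h t) ω) (A.policy₂ t (past h t) ω) (h t)

/-- The regret accumulated over the `T` rounds `h` with seed `ω`. -/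
noncomputable def regret (A : OnlineAlgorithm D K Ω) (I : Problem D K) {T : ℕ}
    (ω : Ω) (h : Fin T → Round D K) : ℝ :=
  ∑ t : Fin T, (I.optNsw -
    (I.nsw (A.policy₁ t (past h t) ω) + I.nsw (A.policy₂ t (past h t) ω)) / 2)

/-- The expected regret over the horizon `T`; the expectation is over the seed, the arms drawn
from the policies, and the feedback. -/
noncomputable def expectedRegret (A : OnlineAlgorithm D K Ω) (I : Problem D K) (T : ℕ) : ℝ :=
  ∫ ω, ∑ h : Fin T → Round D K, A.historyProb I ω h * A.regret I ω h ∂A.seedLaw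

end OnlineAlgorithm

end FairDueling

/-! Two arms `a`, `b` are within a tiny `δ` of every user's Condorcet winner, and n = min(K, D) - 2
users have distinct winners outside {a, b}. A winner is worthless to users with another winner, so
weight outside {a, b} costs a constant factor of welfare (`nsw_twoArm_le`). Yet a hidden defect `ε`
of `s` ∈ {a, b} for user `u` shows up only when `s` meets the winner of `u`; all other comparisons
have the same law (`roundProb_hub_eq`).

Let Q(i) be the expected weight on arm i, for a fixed seed, in the defect-free instance. The
relative entropy to the instance with defect (u, s) is at most 6 ε² Q(w u), so the law of the
history hardly changes unless Q(w u) is of order ε⁻² (`sum_abs_historyProb_sub_le`). Exploring all n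
users thus costs regret of order n ε⁻². Without exploration, the weight of about 2T on a and b
persists in the defective instances. Summed over both choices of `s`, it makes regret of order ε T.
The two costs balance at ε of order (n/T)^(1/3), which gives T^(2/3) n^(1/3).

`sum_seedRegret_ge` combines these facts into a bound on a weighted sum of regrets for every seed.
Integrating over the seed shows that one of finitely many fixed instances is bad
(`exists_expectedRegret_ge`). -/

namespace FairDueling

/-! ### Laws of adaptive trajectories: tower property and total variation -/

section Trajectories

variable {R : Type*}

/-- The probability of a trajectory whose step `t` has, given the earlier steps, the law `r t`. -/
noncomputable def trajProb (r : (t : ℕ) → (Fin t → R) → R → ℝ) {T : ℕ} (h : Fin T → R) : ℝ :=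
  ∏ t : Fin T, r t (fun s => h (Fin.castLE t.isLt.le s)) (h t)

theorem trajProb_snoc (r : (t : ℕ) → (Fin t → R) → R → ℝ) {T : ℕ} (h : Fin T → R) (o : R) :
    trajProb r (Fin.snoc h o : Fin (T + 1) → R) = trajProb r h * r T h o := by
  unfold trajProb
  rw [Fin.prod_univ_castSucc]
  congr 1
  · refine Finset.prod_congr rfl fun t _ => ?_
    rw [Fin.snoc_castSucc]
    congr 1
    funext s
    have : Fin.castLE (Fin.castSucc t).isLt.le s = Fin.castSucc (Fin.castLE t.isLt.le s) := rfl
    rw [this, Fin.snoc_castSucc]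
  · rw [Fin.snoc_last]
    congr 1
    funext s
    have : Fin.castLE (Fin.last T).isLt.le s = Fin.castSucc s := rfl
    rw [this, Fin.snoc_castSucc]

theorem trajProb_nonneg {r : (t : ℕ) → (Fin t → R) → R → ℝ} (hr : ∀ t h o, 0 ≤ r t h o) {T : ℕ}
    (h : Fin T → R) : 0 ≤ trajProb r h :=
  Finset.prod_nonneg fun _ _ => hr _ _ _

variable [Fintype R]

theorem sum_fin_succ_eq {T : ℕ} (F : (Fin (T + 1) → R) → ℝ) :
    ∑ h, F h = ∑ h : Fin T → R, ∑ o : R, F (Fin.snoc h o) := by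
  rw [← Equiv.sum_comp (Fin.snocEquiv fun _ : Fin (T + 1) => R), Fintype.sum_prod_type,
    Finset.sum_comm]
  rfl

theorem sum_trajProb {r : (t : ℕ) → (Fin t → R) → R → ℝ} (hr : ∀ t h, ∑ o, r t h o = 1) (T : ℕ) :
    ∑ h : Fin T → R, trajProb r h = 1 := by
  induction T with
  | zero => simp [trajProb]
  | succ T ih =>
    rw [sum_fin_succ_eq, ← ih]
    refine Finset.sum_congr rfl fun h _ => ?_
    simp_rw [trajProb_snoc]
    rw [← Finset.mul_sum, hr, mul_one]

/-- The expectation of an additive functional is bounded through its conditional expectations. -/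
theorem sum_trajProb_mul_sum_le {r : (t : ℕ) → (Fin t → R) → R → ℝ}
    (hr0 : ∀ t h o, 0 ≤ r t h o) (hr : ∀ t h, ∑ o, r t h o = 1) (l : R → ℝ)
    (g : (t : ℕ) → (Fin t → R) → ℝ) (hg : ∀ t h, ∑ o, r t h o * l o ≤ g t h) (T : ℕ) :
    ∑ h : Fin T → R, trajProb r h * ∑ t, l (h t) ≤
      ∑ h : Fin T → R, trajProb r h *
        ∑ t : Fin T, g t (fun s => h (Fin.castLE t.isLt.le s)) := by
  induction T with
  | zero => simp
  | succ T ih =>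
    -- Condition on the first T steps: the last step contributes its conditional expectation, and
    -- the earlier terms keep their weight because `r T h` has total mass one.
    have e1 : ∀ h : Fin T → R, ∑ o, trajProb r (Fin.snoc h o : Fin (T + 1) → R) *
        ∑ t, l ((Fin.snoc h o : Fin (T + 1) → R) t) =
        trajProb r h * ∑ t, l (h t) + trajProb r h * ∑ o, r T h o * l o := by
      intro h
      have : ∀ o, trajProb r (Fin.snoc h o : Fin (T + 1) → R) *
          ∑ t, l ((Fin.snoc h o : Fin (T + 1) → R) t) =
          (trajProb r h * ∑ t, l (h t)) * r T h o + trajProb r h * (r T h o * l o) := by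
        intro o
        rw [trajProb_snoc, Fin.sum_univ_castSucc]
        simp only [Fin.snoc_castSucc, Fin.snoc_last]
        ring
      simp_rw [this]
      rw [Finset.sum_add_distrib, ← Finset.mul_sum, ← Finset.mul_sum, hr, mul_one]
    have e2 : ∀ h : Fin T → R, ∑ o, trajProb r (Fin.snoc h o : Fin (T + 1) → R) *
        ∑ t : Fin (T + 1), g t (fun s =>
          (Fin.snoc h o : Fin (T + 1) → R) (Fin.castLE t.isLt.le s)) =
        trajProb r h * ∑ t : Fin T, g t (fun s => h (Fin.castLE t.isLt.le s)) +
          trajProb r h * g T h := by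
      intro h
      have : ∀ o, trajProb r (Fin.snoc h o : Fin (T + 1) → R) *
        ∑ t : Fin (T + 1), g t (fun s =>
          (Fin.snoc h o : Fin (T + 1) → R) (Fin.castLE t.isLt.le s)) =
          (trajProb r h * ∑ t : Fin T, g t (fun s => h (Fin.castLE t.isLt.le s)) +
          trajProb r h * g T h) * r T h o := by
        intro o
        have h1 : ∀ (t : Fin T), (fun s => (Fin.snoc h o : Fin (T + 1) → R)
            (Fin.castLE (Fin.castSucc t).isLt.le s)) = fun s => h (Fin.castLE t.isLt.le s) := by
          intro t
          funext s
          exact Fin.snoc_castSucc (α := fun _ => R) o h (Fin.castLE t.isLt.le s)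
        have h2 : (fun s => (Fin.snoc h o : Fin (T + 1) → R)
            (Fin.castLE (Fin.last T).isLt.le s)) = h := by
          funext s
          exact Fin.snoc_castSucc (α := fun _ => R) o h s
        have h3 : ∑ t : Fin (T + 1), g t (fun s =>
            (Fin.snoc h o : Fin (T + 1) → R) (Fin.castLE t.isLt.le s)) =
            ∑ t : Fin T, g t (fun s => h (Fin.castLE t.isLt.le s)) + g T h := by
          rw [Fin.sum_univ_castSucc]
          congr 1
          · exact Finset.sum_congr rfl fun t _ => congrArg (g t) (h1 t)
          · exact congrArg (g T) h2
        rw [trajProb_snoc, h3]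
        ring
      simp_rw [this]
      rw [← Finset.mul_sum, hr, mul_one]
    rw [sum_fin_succ_eq, sum_fin_succ_eq]
    simp_rw [e1, e2]
    rw [Finset.sum_add_distrib, Finset.sum_add_distrib]
    refine add_le_add ih (Finset.sum_le_sum fun h _ => ?_)
    exact mul_le_mul_of_nonneg_left (hg T h) (trajProb_nonneg hr0 h)

/-- A pointwise, linear substitute for Pinsker's inequality. With u = exp(-L/2) one has L ≥ 2(1 -
u), so the bracket is at least (1 - u)². Then |1 - u²| = |1 - u|(1 + u) is split by AM-GM, using (1
+ u)² ≤ 2(1 + u²). -/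
theorem abs_one_sub_exp_neg_le (L : ℝ) :
    |1 - Real.exp (-L)| ≤ 8 * (Real.exp (-L) - 1 + L) + (1 + Real.exp (-L)) / 16 := by
  have h1 : Real.exp (-L) = Real.exp (-L / 2) ^ 2 := by
    rw [← Real.exp_nat_mul]; congr 1; push_cast; ring
  have h2 : -L / 2 + 1 ≤ Real.exp (-L / 2) := Real.add_one_le_exp _
  rw [h1]
  set u := Real.exp (-L / 2)
  rw [abs_le]
  constructor <;> nlinarith [sq_nonneg (16 * (1 - u) - (1 + u)), sq_nonneg (16 * (1 - u) + (1 + u)),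
    sq_nonneg (1 - u)]

/-- The total variation of two trajectory laws is bounded by the relative entropy. -/
theorem sum_abs_trajProb_sub_le {r r' : (t : ℕ) → (Fin t → R) → R → ℝ}
    (hr0 : ∀ t h o, 0 ≤ r t h o) (hr : ∀ t h, ∑ o, r t h o = 1)
    (hr' : ∀ t h, ∑ o, r' t h o = 1) (l : R → ℝ)
    (hl : ∀ t h o, r' t h o = r t h o * Real.exp (-l o)) (T : ℕ) :
    ∑ h : Fin T → R, |trajProb r h - trajProb r' h| ≤
      8 * (∑ h : Fin T → R, trajProb r h * ∑ t, l (h t)) + 1 / 8 := by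
  have key : ∀ h : Fin T → R, trajProb r' h = trajProb r h * Real.exp (-∑ t, l (h t)) := by
    intro h
    unfold trajProb
    simp_rw [hl]
    rw [Finset.prod_mul_distrib, ← Real.exp_sum, Finset.sum_neg_distrib]
  have pt : ∀ h : Fin T → R, |trajProb r h - trajProb r' h| ≤
      8 * (trajProb r' h - trajProb r h + trajProb r h * ∑ t, l (h t)) +
        (trajProb r h + trajProb r' h) / 16 := by
    intro h
    have h0 := trajProb_nonneg hr0 h
    have h1 := mul_le_mul_of_nonneg_left (abs_one_sub_exp_neg_le (∑ t, l (h t))) h0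
    rw [key]
    have h2 : |trajProb r h - trajProb r h * Real.exp (-∑ t, l (h t))| =
        trajProb r h * |1 - Real.exp (-∑ t, l (h t))| := by
      rw [← abs_of_nonneg h0, ← abs_mul, abs_of_nonneg h0]; congr 1; ring
    rw [h2]
    refine h1.trans (le_of_eq ?_)
    ring
  -- Both laws have total mass one, so the differences cancel and the last term sums to 2/16 = 1/8.
  refine (Finset.sum_le_sum fun h _ => pt h).trans (le_of_eq ?_)
  rw [Finset.sum_add_distrib, ← Finset.mul_sum, Finset.sum_add_distrib, Finset.sum_sub_distrib,
    ← Finset.sum_div, Finset.sum_add_distrib, sum_trajProb hr, sum_trajProb hr']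
  ring

end Trajectories

/-! ### Bernoulli answers: entropy bound and marginals -/

section Bernoulli

/-- The relative entropy of two Bernoulli laws is at most their chi-square divergence. -/
theorem bernoulli_entropy_le {p q : ℝ} (hp0 : 0 < p) (hp1 : p < 1) (hq0 : 0 < q) (hq1 : q < 1) :
    p * Real.log (p / q) + (1 - p) * Real.log ((1 - p) / (1 - q)) ≤
      (p - q) ^ 2 / (q * (1 - q)) := by
  have h1 := Real.log_le_sub_one_of_pos (div_pos hp0 hq0)
  have h2 := Real.log_le_sub_one_of_pos (div_pos (sub_pos.2 hp1) (sub_pos.2 hq1))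
  have h3 := mul_le_mul_of_nonneg_left h1 hp0.le
  have h4 := mul_le_mul_of_nonneg_left h2 (sub_pos.2 hp1).le
  have hq' : 1 - q ≠ 0 := (sub_pos.2 hq1).ne'
  refine (add_le_add h3 h4).trans (le_of_eq ?_)
  field_simp
  ring

/-- Marginalization: the answers of users other than `j` sum to one. The log-likelihood ratios below
depend on a single user's answer. -/
theorem sum_prod_bool_mul {ι : Type*} [Fintype ι] [DecidableEq ι] (q : ι → ℝ) (j : ι)
    (φ : Bool → ℝ) :
    ∑ y : ι → Bool, (∏ d, if y d then q d else 1 - q d) * φ (y j) =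
      q j * φ true + (1 - q j) * φ false := by
  have h1 : ∀ y : ι → Bool, (∏ d, if y d then q d else 1 - q d) * φ (y j) =
      ∏ d, ((if y d then q d else 1 - q d) * if d = j then φ (y d) else 1) := by
    intro y
    rw [Finset.prod_mul_distrib]
    simp
  simp_rw [h1]
  rw [← Fintype.piFinset_univ, ← Finset.prod_univ_sum (fun _ => (Finset.univ : Finset Bool))
    (fun d b => (if b = true then q d else 1 - q d) * if d = j then φ b else 1),
    Finset.prod_eq_single j]
  · simp
  · intro d _ hd
    simp [hd]
  · simp

end Bernoulli

/-! ### General facts on rounds, scores and welfare -/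

namespace Problem

variable {D K : ℕ}

theorem roundProb_nonneg (I : Problem D K) (p q : Policy K) (o : Round D K) :
    0 ≤ I.roundProb p q o := by
  refine mul_nonneg (mul_nonneg (p.2.1 _) (q.2.1 _)) (Finset.prod_nonneg fun d _ => ?_)
  have := I.pref_mem d o.1 o.2.1
  split_ifs
  · exact this.1
  · linarith [this.2]

theorem sum_roundProb_mul (I : Problem D K) (p q : Policy K) (j : Fin D)
    (l : Fin K → Fin K → Bool → ℝ) :
    ∑ o : Round D K, I.roundProb p q o * l o.1 o.2.1 (o.2.2 j) =
      ∑ i, ∑ k, (p : Fin K → ℝ) i * (q : Fin K → ℝ) k *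
        (I.pref j i k * l i k true + (1 - I.pref j i k) * l i k false) := by
  rw [Fintype.sum_prod_type]
  refine Finset.sum_congr rfl fun i _ => ?_
  rw [Fintype.sum_prod_type]
  refine Finset.sum_congr rfl fun k _ => ?_
  rw [← sum_prod_bool_mul (fun d => I.pref d i k) j (l i k), Finset.mul_sum]
  refine Finset.sum_congr rfl fun y _ => ?_
  simp only [roundProb]
  ring

theorem sum_sum_policy (p q : Policy K) :
    ∑ i, ∑ k, (p : Fin K → ℝ) i * (q : Fin K → ℝ) k = 1 := by
  simp_rw [← Finset.mul_sum]
  rw [← Finset.sum_mul, stdSimplex.sum_eq_one, stdSimplex.sum_eq_one, one_mul]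

theorem sum_roundProb (I : Problem D K) (hD : 0 < D) (p q : Policy K) :
    ∑ o : Round D K, I.roundProb p q o = 1 := by
  have := I.sum_roundProb_mul p q ⟨0, hD⟩ fun _ _ _ => 1
  simp only [mul_one, add_sub_cancel, sum_sum_policy] at this
  exact this

theorem score_nonneg (I : Problem D K) (d : Fin D) (i : Fin K) : 0 ≤ I.score d i :=
  mul_nonneg zero_le_two (I.pref_mem d _ _).1

theorem score_le_one (I : Problem D K) (d : Fin D) (i : Fin K) : I.score d i ≤ 1 := by
  unfold score
  rcases eq_or_ne i (I.winner d) with rfl | h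
  · rw [I.pref_self]; norm_num
  · linarith [I.winner_spec d i h, I.pref_add_swap d i (I.winner d)]

theorem sum_mul_score_nonneg (I : Problem D K) (π : Policy K) (d : Fin D) :
    0 ≤ ∑ a, (π : Fin K → ℝ) a * I.score d a :=
  Finset.sum_nonneg fun a _ => mul_nonneg (π.2.1 a) (I.score_nonneg d a)

theorem sum_mul_score_le_one (I : Problem D K) (π : Policy K) (d : Fin D) :
    ∑ a, (π : Fin K → ℝ) a * I.score d a ≤ 1 := by
  rw [← π.2.2]
  exact Finset.sum_le_sum fun a _ => mul_le_of_le_one_right (π.2.1 a) (I.score_le_one d a)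

/-- Every factor lies in [0, 1], so users may be dropped; one or two users suffice for the upper
bounds below. -/
theorem nsw_le_prod (I : Problem D K) (π : Policy K) (S : Finset (Fin D)) :
    I.nsw π ≤ ∏ d ∈ S, ∑ a, (π : Fin K → ℝ) a * I.score d a := by
  unfold nsw
  rw [← Finset.prod_mul_prod_compl S]
  refine mul_le_of_le_one_right (Finset.prod_nonneg fun d _ => I.sum_mul_score_nonneg π d) ?_
  exact Finset.prod_le_one (fun d _ => I.sum_mul_score_nonneg π d)
    fun d _ => I.sum_mul_score_le_one π d

theorem nsw_le_optNsw [NeZero K] (I : Problem D K) (π : Policy K) : I.nsw π ≤ I.optNsw := by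
  obtain ⟨x, hx, h⟩ := I.exists_optimal
  exact h ▸ hx π

/-- An arm all of whose scores are at least `1 - η` bounds the optimal welfare from below. -/
theorem one_sub_le_optNsw [NeZero K] (I : Problem D K) (i : Fin K) {η : ℝ} (hη : η ≤ 1)
    (h : ∀ d, 1 - η ≤ I.score d i) : 1 - D * η ≤ I.optNsw := by
  refine le_trans ?_ (I.nsw_le_optNsw ⟨Pi.single i 1, single_mem_stdSimplex ℝ i⟩)
  have h1 : I.nsw ⟨Pi.single i 1, single_mem_stdSimplex ℝ i⟩ = ∏ d, I.score d i := by
    unfold nsw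
    refine Finset.prod_congr rfl fun d _ => ?_
    simp [Pi.single_apply]
  rw [h1]
  have h2 : (1 - η) ^ D ≤ ∏ d, I.score d i := by
    have := Finset.prod_le_prod (s := (Finset.univ : Finset (Fin D))) (f := fun _ => 1 - η)
      (g := fun d => I.score d i) (fun _ _ => sub_nonneg.2 hη) (fun d _ => h d)
    simpa using this
  refine le_trans ?_ h2
  -- Bernoulli's inequality.
  have := one_add_mul_le_pow (a := -η) (by linarith) D
  rw [← sub_eq_add_neg] at this
  linarith

end Problem

/-! ### Hub instances: information comes only from a user's winner -/

namespace Problem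

variable {D K : ℕ}

/-- The instance in which user `d` prefers the arm `w d` over everything, prefers each other arm
`i` over `w d` with probability `θ d i`, and is indifferent otherwise. -/
noncomputable def hub (w : Fin D → Fin K) (θ : Fin D → Fin K → ℝ) (hθ₀ : ∀ d i, 0 ≤ θ d i)
    (hθ : ∀ d i, θ d i < 1 / 2) : Problem D K where
  pref d i j := if i = j then 1 / 2 else if i = w d then 1 - θ d j else
    if j = w d then θ d i else 1 / 2
  pref_mem d i j := by
    have h1 := hθ₀ d i
    have h2 := hθ d i
    have h3 := hθ₀ d j
    have h4 := hθ d j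
    split_ifs <;> constructor <;> linarith
  pref_add_swap d i j := by
    by_cases hij : i = j
    · subst hij; norm_num
    · have hji : ¬ j = i := Ne.symm hij
      by_cases hi : i = w d
      · have hj : ¬ j = w d := fun h => hij (hi.trans h.symm)
        rw [if_neg hij, if_neg hji, if_pos hi, if_neg hj, if_pos hi]
        ring
      · simp only [hij, hji, hi, if_false]
        split_ifs <;> norm_num
  pref_self d i := by simp
  winner := w
  winner_spec d j hj := by
    rw [if_neg (Ne.symm hj), if_pos rfl]
    linarith [hθ d j]

section Hub

variable {w : Fin D → Fin K} {θ θ' : Fin D → Fin K → ℝ} {hθ₀ : ∀ d i, 0 ≤ θ d i}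
  {hθ : ∀ d i, θ d i < 1 / 2} {hθ₀' : ∀ d i, 0 ≤ θ' d i} {hθ' : ∀ d i, θ' d i < 1 / 2}

theorem score_hub (d : Fin D) (i : Fin K) :
    (hub w θ hθ₀ hθ).score d i = if i = w d then 1 else 2 * θ d i := by
  simp only [score, hub]
  split_ifs <;> norm_num

/-- The log-likelihood ratio of one round for two hub instances whose parameters differ only for
one user and one arm `s`, where they are `x` and `x'`; the hub of that user is `v`. -/
noncomputable def hubLogRatio (v s : Fin K) (x x' : ℝ) (i k : Fin K) (y : Bool) : ℝ :=
  if i = s ∧ k = v then (if y then Real.log (x / x') else Real.log ((1 - x) / (1 - x')))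
  else if i = v ∧ k = s then (if y then Real.log ((1 - x) / (1 - x')) else Real.log (x / x'))
  else 0

theorem mul_exp_neg_log_div {x x' : ℝ} (hx : 0 < x) (hx' : 0 < x') :
    x * Real.exp (-Real.log (x / x')) = x' := by
  rw [Real.exp_neg, Real.exp_log (div_pos hx hx')]
  field_simp

/-- The parameter `θ u s` enters only the answer of `u` to the pair {s, w u}, in either order; every
other factor of the round's probability is common to both instances. -/
theorem roundProb_hub_eq (u : Fin D) (s : Fin K) (hs : s ≠ w u)
    (hne : ∀ d i, ¬(d = u ∧ i = s) → θ' d i = θ d i) (hx : 0 < θ u s) (hx' : 0 < θ' u s)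
    (p q : Policy K) (o : Round D K) :
    (hub w θ' hθ₀' hθ').roundProb p q o = (hub w θ hθ₀ hθ).roundProb p q o *
      Real.exp (-hubLogRatio (w u) s (θ u s) (θ' u s) o.1 o.2.1 (o.2.2 u)) := by
  obtain ⟨i, k, y⟩ := o
  simp only [roundProb]
  rw [mul_assoc _ (∏ d, _) _]
  congr 1
  have h1 : Real.exp (-hubLogRatio (w u) s (θ u s) (θ' u s) i k (y u)) =
      ∏ d, if d = u then Real.exp (-hubLogRatio (w u) s (θ u s) (θ' u s) i k (y d)) else 1 := by
    simp
  rw [h1, ← Finset.prod_mul_distrib]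
  refine Finset.prod_congr rfl fun d _ => ?_
  have hy : 0 < 1 - θ u s := by linarith [hθ u s]
  have hy' : 0 < 1 - θ' u s := by linarith [hθ' u s]
  by_cases hd : d = u
  · subst hd
    rw [if_pos rfl]
    simp only [hub, hubLogRatio]
    by_cases h1 : i = s ∧ k = w d
    · obtain ⟨rfl, rfl⟩ := h1
      simp only [hs, and_self, if_true, if_false]
      cases y d
      · simp [mul_exp_neg_log_div hy hy']
      · simp [mul_exp_neg_log_div hx hx']
    · rw [if_neg h1]
      by_cases h2 : i = w d ∧ k = s
      · obtain ⟨rfl, rfl⟩ := h2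
        simp only [hs.symm, and_self, if_true, if_false]
        cases y d
        · simp [mul_exp_neg_log_div hx hx']
        · simp [mul_exp_neg_log_div hy hy']
      · rw [if_neg h2]
        simp only [neg_zero, Real.exp_zero, mul_one]
        have e : (if i = k then (1 / 2 : ℝ) else if i = w d then 1 - θ' d k else
            if k = w d then θ' d i else 1 / 2) = (if i = k then 1 / 2 else if i = w d then
            1 - θ d k else if k = w d then θ d i else 1 / 2) := by
          split_ifs with a1 a2 a3
          · rfl
          · rw [hne d k fun h => h2 ⟨a2, h.2⟩]
          · rw [hne d i fun h => h1 ⟨h.2, a3⟩]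
          · rfl
        rw [e]
  · rw [if_neg hd, mul_one]
    simp only [hub, hne d _ fun h => hd h.1]

/-- Information gained in one round: each order of the pair {s, w u} yields at most the chi-square
divergence, and its probability is at most the weight that one of the policies puts on `w u`. -/
theorem sum_roundProb_hub_mul_le (u : Fin D) (s : Fin K) (hs : s ≠ w u) (hx : 0 < θ u s)
    (hx' : 0 < θ' u s) (hx2 : θ' u s < 1 / 2) (p q : Policy K) :
    ∑ o : Round D K, (hub w θ hθ₀ hθ).roundProb p q o *
      hubLogRatio (w u) s (θ u s) (θ' u s) o.1 o.2.1 (o.2.2 u) ≤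
      (θ u s - θ' u s) ^ 2 / (θ' u s * (1 - θ' u s)) *
        ((p : Fin K → ℝ) (w u) + (q : Fin K → ℝ) (w u)) := by
  set C := (θ u s - θ' u s) ^ 2 / (θ' u s * (1 - θ' u s)) with hC
  have hent := bernoulli_entropy_le hx (by linarith [hθ u s]) hx' (by linarith : θ' u s < 1)
  have hC0 : 0 ≤ C := div_nonneg (sq_nonneg _) (mul_nonneg hx'.le (by linarith))
  rw [sum_roundProb_mul (hub w θ hθ₀ hθ) p q u (hubLogRatio (w u) s (θ u s) (θ' u s))]
  have pt : ∀ i k, (p : Fin K → ℝ) i * (q : Fin K → ℝ) k *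
      ((hub w θ hθ₀ hθ).pref u i k * hubLogRatio (w u) s (θ u s) (θ' u s) i k true +
        (1 - (hub w θ hθ₀ hθ).pref u i k) * hubLogRatio (w u) s (θ u s) (θ' u s) i k false) ≤
      (p : Fin K → ℝ) i * (q : Fin K → ℝ) k *
        (C * ((if k = w u then 1 else 0) + if i = w u then 1 else 0)) := by
    intro i k
    refine mul_le_mul_of_nonneg_left ?_ (mul_nonneg (p.2.1 i) (q.2.1 k))
    by_cases h1 : i = s ∧ k = w u
    · obtain ⟨rfl, rfl⟩ := h1
      simp only [hub, hubLogRatio, hs, and_self, if_true, if_false]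
      simpa using hent
    · by_cases h2 : i = w u ∧ k = s
      · obtain ⟨rfl, rfl⟩ := h2
        simp only [hub, hubLogRatio, hs, hs.symm, and_self, if_true, if_false]
        simp only [Bool.false_eq_true, if_false]
        linarith
      · simp only [hubLogRatio, h1, h2, if_false, mul_zero, add_zero]
        refine mul_nonneg hC0 (add_nonneg ?_ ?_) <;> split_ifs <;> norm_num
  refine (Finset.sum_le_sum fun i _ => Finset.sum_le_sum fun k _ => pt i k).trans (le_of_eq ?_)
  have e : ∀ i k, (p : Fin K → ℝ) i * (q : Fin K → ℝ) k *
        (C * ((if k = w u then 1 else 0) + if i = w u then 1 else 0)) =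
      C * ((p : Fin K → ℝ) i * (if k = w u then (q : Fin K → ℝ) k else 0) +
        (if i = w u then (p : Fin K → ℝ) i else 0) * (q : Fin K → ℝ) k) := by
    intro i k
    split_ifs <;> ring
  simp_rw [e, ← Finset.mul_sum, Finset.sum_add_distrib, ← Finset.mul_sum, ← Finset.sum_mul]
  rw [stdSimplex.sum_eq_one, stdSimplex.sum_eq_one, Finset.sum_ite_eq', Finset.sum_ite_eq']
  simp only [Finset.mem_univ, if_true]
  ring

end Hub

/-! ### Two-arm instances and their welfare -/

/-- Half the scores of two nearly optimal arms `a`, `b` and otherwise worthless arms. -/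
noncomputable def halfScore (a b : Fin K) (δ : ℝ) (e : Fin D → Fin K → ℝ) (d : Fin D)
    (i : Fin K) : ℝ :=
  if i = a ∨ i = b then 1 / 2 - δ - e d i else 0

theorem halfScore_nonneg (a b : Fin K) {δ : ℝ} {e : Fin D → Fin K → ℝ} (hδ : δ ≤ 1 / 8)
    (he : ∀ d i, e d i ≤ 1 / 8) (d : Fin D) (i : Fin K) : 0 ≤ halfScore a b δ e d i := by
  unfold halfScore
  split_ifs <;> linarith [he d i]

theorem halfScore_lt (a b : Fin K) {δ : ℝ} {e : Fin D → Fin K → ℝ} (hδ : 0 < δ)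
    (he : ∀ d i, 0 ≤ e d i) (d : Fin D) (i : Fin K) : halfScore a b δ e d i < 1 / 2 := by
  unfold halfScore
  split_ifs <;> linarith [he d i]

/-- Two good arms `a`, `b`: every user has a Condorcet winner `w d`, which is worthless for the
users with another winner, and is nearly indifferent between `w d` and the arms `a` and `b`, up to
`δ` and the perturbation `e`. -/
noncomputable def twoArm (w : Fin D → Fin K) (a b : Fin K) (δ : ℝ) (e : Fin D → Fin K → ℝ)
    (hδ : 0 < δ) (hδ' : δ ≤ 1 / 8) (he : ∀ d i, 0 ≤ e d i) (he' : ∀ d i, e d i ≤ 1 / 8) :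
    Problem D K :=
  hub w (halfScore a b δ e) (halfScore_nonneg a b hδ' he') (halfScore_lt a b hδ he)

section TwoArm

variable {w : Fin D → Fin K} {a b : Fin K} {δ : ℝ} {e : Fin D → Fin K → ℝ} {hδ : 0 < δ}
  {hδ' : δ ≤ 1 / 8} {he : ∀ d i, 0 ≤ e d i} {he' : ∀ d i, e d i ≤ 1 / 8}

theorem score_twoArm (d : Fin D) (i : Fin K) :
    (twoArm w a b δ e hδ hδ' he he').score d i =
      if i = w d then 1 else if i = a ∨ i = b then 1 - 2 * δ - 2 * e d i else 0 := by
  rw [twoArm, score_hub, halfScore]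
  split_ifs <;> ring

theorem optNsw_twoArm_ge [NeZero K] (i : Fin K) (hi : i = a ∨ i = b)
    (h0 : ∀ d, e d i = 0) : 1 - 2 * δ * D ≤ (twoArm w a b δ e hδ hδ' he he').optNsw := by
  have := one_sub_le_optNsw (twoArm w a b δ e hδ hδ' he he') i (η := 2 * δ) (by linarith)
    (fun d => by
      rw [score_twoArm, if_pos hi, h0]
      split_ifs <;> linarith)
  linarith

/-- Mass on an arm that is perturbed for some user costs welfare. -/
theorem nsw_twoArm_le_of_perturbed (u : Fin D) (s : Fin K) (hs : s = a ∨ s = b) (hsw : s ≠ w u)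
    (π : Policy K) :
    (twoArm w a b δ e hδ hδ' he he').nsw π ≤ 1 - 2 * e u s * (π : Fin K → ℝ) s := by
  refine (nsw_le_prod _ π {u}).trans ?_
  rw [Finset.prod_singleton]
  have h1 : ∀ i, (π : Fin K → ℝ) i * (twoArm w a b δ e hδ hδ' he he').score u i ≤
      (π : Fin K → ℝ) i - if i = s then 2 * e u s * (π : Fin K → ℝ) i else 0 := by
    intro i
    have hπ : 0 ≤ (π : Fin K → ℝ) i := π.2.1 i
    split_ifs with h
    · subst h
      rw [score_twoArm, if_neg hsw, if_pos hs]
      nlinarith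
    · have := mul_le_mul_of_nonneg_left ((twoArm w a b δ e hδ hδ' he he').score_le_one u i) hπ
      linarith
  refine (Finset.sum_le_sum fun i _ => h1 i).trans (le_of_eq ?_)
  rw [Finset.sum_sub_distrib, stdSimplex.sum_eq_one, Finset.sum_ite_eq']
  simp

theorem sum_score_twoArm_le (d : Fin D) (π : Policy K) :
    ∑ i, (π : Fin K → ℝ) i * (twoArm w a b δ e hδ hδ' he he').score d i ≤
      (π : Fin K → ℝ) a + (π : Fin K → ℝ) b + (π : Fin K → ℝ) (w d) := by
  have h1 : ∀ i, (π : Fin K → ℝ) i * (twoArm w a b δ e hδ hδ' he he').score d i ≤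
      (if i = a then (π : Fin K → ℝ) i else 0) + (if i = b then (π : Fin K → ℝ) i else 0) +
        if i = w d then (π : Fin K → ℝ) i else 0 := by
    intro i
    have hπ : 0 ≤ (π : Fin K → ℝ) i := π.2.1 i
    have hle := mul_le_mul_of_nonneg_left
      ((twoArm w a b δ e hδ hδ' he he').score_le_one d i) hπ
    by_cases h1 : i = w d
    · rw [if_pos h1]
      split_ifs <;> linarith
    · by_cases h2 : i = a
      · rw [if_pos h2]
        split_ifs <;> linarith
      · by_cases h3 : i = b
        · rw [if_neg h2, if_pos h3, if_neg h1]
          linarith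
        · simp [score_twoArm, h1, h2, h3]
  refine (Finset.sum_le_sum fun i _ => h1 i).trans (le_of_eq ?_)
  simp [Finset.sum_add_distrib]

theorem sum_policy_le_one (π : Policy K) (S : Finset (Fin K)) :
    ∑ i ∈ S, (π : Fin K → ℝ) i ≤ 1 := by
  rw [← stdSimplex.sum_eq_one π]
  exact Finset.sum_le_sum_of_subset_of_nonneg (Finset.subset_univ _) fun i _ _ => π.2.1 i

/-- Mass outside the two good arms costs welfare as soon as two users disagree. -/
theorem nsw_twoArm_le (hab : a ≠ b) (d₁ d₂ : Fin D) (hw : w d₁ ≠ w d₂)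
    (ha₁ : a ≠ w d₁) (hb₁ : b ≠ w d₁) (ha₂ : a ≠ w d₂) (hb₂ : b ≠ w d₂) (π : Policy K) :
    (twoArm w a b δ e hδ hδ' he he').nsw π ≤
      1 - 3 / 4 * (1 - (π : Fin K → ℝ) a - (π : Fin K → ℝ) b) := by
  have hd : d₁ ≠ d₂ := fun h => hw (congrArg w h)
  refine (nsw_le_prod _ π {d₁, d₂}).trans ?_
  rw [Finset.prod_pair hd]
  have h1 := sum_score_twoArm_le (w := w) (a := a) (b := b) (δ := δ) (e := e) (hδ := hδ) (hδ' := hδ') (he := he)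
    (he' := he') d₁ π
  have h2 := sum_score_twoArm_le (w := w) (a := a) (b := b) (δ := δ) (e := e) (hδ := hδ) (hδ' := hδ') (he := he)
    (he' := he') d₂ π
  have h3 := sum_mul_score_nonneg (twoArm w a b δ e hδ hδ' he he') π d₁
  have h4 := sum_mul_score_nonneg (twoArm w a b δ e hδ hδ' he he') π d₂
  have h5 := sum_policy_le_one π {a, b, w d₁, w d₂}
  rw [Finset.sum_insert (by simp [*]), Finset.sum_insert (by simp [*]),
    Finset.sum_insert (by simp [*]), Finset.sum_singleton] at h5
  have p1 : 0 ≤ (π : Fin K → ℝ) a := π.2.1 a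
  have p2 : 0 ≤ (π : Fin K → ℝ) b := π.2.1 b
  have p3 : 0 ≤ (π : Fin K → ℝ) (w d₁) := π.2.1 _
  have p4 : 0 ≤ (π : Fin K → ℝ) (w d₂) := π.2.1 _
  refine (mul_le_mul h1 h2 h4 (h3.trans h1)).trans ?_
  -- With m = 1 - A - B and P + Q ≤ m, the product is at most (1 - m/2)² = 1 - m + m²/4 ≤ 1 - 3m/4.
  generalize (π : Fin K → ℝ) a = A at *
  generalize (π : Fin K → ℝ) b = B at *
  generalize (π : Fin K → ℝ) (w d₁) = P at *
  generalize (π : Fin K → ℝ) (w d₂) = Q at *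
  nlinarith [sq_nonneg (P - Q), mul_nonneg (add_nonneg p1 p2) (sub_nonneg.2 h5),
    mul_nonneg (add_nonneg p3 p4) (sub_nonneg.2 h5), sq_nonneg (P + Q - (1 - A - B))]

end TwoArm

end Problem

/-! ### Regret and change of instance for a fixed seed -/

namespace OnlineAlgorithm

variable {D K : ℕ} {Ω : Type*} [MeasurableSpace Ω]

/-- The total weight that the two policies put on the arm `i` during the rounds `h`. -/
noncomputable def mass (A : OnlineAlgorithm D K Ω) {T : ℕ} (ω : Ω) (h : Fin T → Round D K)
    (i : Fin K) : ℝ :=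
  ∑ t : Fin T, ((A.policy₁ t (past h t) ω : Fin K → ℝ) i + (A.policy₂ t (past h t) ω : Fin K → ℝ) i)

/-- The expected regret given the seed. -/
noncomputable def seedRegret (A : OnlineAlgorithm D K Ω) (I : Problem D K) (T : ℕ) (ω : Ω) : ℝ :=
  ∑ h : Fin T → Round D K, A.historyProb I ω h * A.regret I ω h

variable (A : OnlineAlgorithm D K Ω) {T : ℕ} (ω : Ω)

theorem historyProb_nonneg (I : Problem D K) (h : Fin T → Round D K) : 0 ≤ A.historyProb I ω h :=
  Finset.prod_nonneg fun _ _ => I.roundProb_nonneg _ _ _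

theorem sum_historyProb (I : Problem D K) (hD : 0 < D) :
    ∑ h : Fin T → Round D K, A.historyProb I ω h = 1 :=
  sum_trajProb (r := fun t h => I.roundProb (A.policy₁ t h ω) (A.policy₂ t h ω))
    (fun _ _ => I.sum_roundProb hD _ _) T

theorem mass_nonneg (h : Fin T → Round D K) (i : Fin K) : 0 ≤ A.mass ω h i :=
  Finset.sum_nonneg fun _ _ => add_nonneg ((A.policy₁ _ _ _).2.1 i) ((A.policy₂ _ _ _).2.1 i)

theorem sum_mass_le (h : Fin T → Round D K) (S : Finset (Fin K)) :
    ∑ i ∈ S, A.mass ω h i ≤ 2 * T := by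
  unfold mass
  rw [Finset.sum_comm]
  have : ∀ t : Fin T, ∑ i ∈ S, ((A.policy₁ t (past h t) ω : Fin K → ℝ) i +
      (A.policy₂ t (past h t) ω : Fin K → ℝ) i) ≤ 2 := fun t => by
    rw [Finset.sum_add_distrib]
    linarith [Problem.sum_policy_le_one (A.policy₁ t (past h t) ω) S,
      Problem.sum_policy_le_one (A.policy₂ t (past h t) ω) S]
  refine (Finset.sum_le_sum fun t _ => this t).trans (le_of_eq ?_)
  simp [mul_comm]

theorem mass_le (h : Fin T → Round D K) (i : Fin K) : A.mass ω h i ≤ 2 * T := by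
  simpa using A.sum_mass_le ω h {i}

theorem regret_ge_of_two_arms {I : Problem D K} {a b : Fin K} {c η : ℝ} (hopt : 1 - η ≤ I.optNsw)
    (hnsw : ∀ π : Policy K, I.nsw π ≤ 1 - c * (1 - (π : Fin K → ℝ) a - (π : Fin K → ℝ) b))
    (h : Fin T → Round D K) :
    c / 2 * (2 * T - A.mass ω h a - A.mass ω h b) - η * T ≤ A.regret I ω h := by
  have e : c / 2 * (2 * T - A.mass ω h a - A.mass ω h b) - η * T =
      ∑ t : Fin T, (c / 2 * (2 -
        ((A.policy₁ t (past h t) ω : Fin K → ℝ) a + (A.policy₂ t (past h t) ω : Fin K → ℝ) a) -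
        ((A.policy₁ t (past h t) ω : Fin K → ℝ) b + (A.policy₂ t (past h t) ω : Fin K → ℝ) b))
        - η) := by
    rw [Finset.sum_sub_distrib, ← Finset.mul_sum, Finset.sum_sub_distrib, Finset.sum_sub_distrib]
    simp [mass, mul_comm]
  rw [e]
  refine Finset.sum_le_sum fun t _ => ?_
  linarith [hnsw (A.policy₁ t (past h t) ω), hnsw (A.policy₂ t (past h t) ω)]

theorem regret_ge_of_arm {I : Problem D K} {s : Fin K} {c η : ℝ} (hopt : 1 - η ≤ I.optNsw)
    (hnsw : ∀ π : Policy K, I.nsw π ≤ 1 - 2 * c * (π : Fin K → ℝ) s) (h : Fin T → Round D K) :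
    c * A.mass ω h s - η * T ≤ A.regret I ω h := by
  have e : c * A.mass ω h s - η * T = ∑ t : Fin T, (c *
      ((A.policy₁ t (past h t) ω : Fin K → ℝ) s + (A.policy₂ t (past h t) ω : Fin K → ℝ) s)
        - η) := by
    rw [Finset.sum_sub_distrib, ← Finset.mul_sum]
    simp [mass, mul_comm]
  rw [e]
  refine Finset.sum_le_sum fun t _ => ?_
  linarith [hnsw (A.policy₁ t (past h t) ω), hnsw (A.policy₂ t (past h t) ω)]

theorem seedRegret_ge {I : Problem D K} (hD : 0 < D) {F : (Fin T → Round D K) → ℝ} {c η : ℝ}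
    (hF : ∀ h, c * F h - η ≤ A.regret I ω h) :
    c * ∑ h, A.historyProb I ω h * F h - η ≤ A.seedRegret I T ω := by
  have := Finset.sum_le_sum fun h (_ : h ∈ Finset.univ) =>
    mul_le_mul_of_nonneg_left (hF h) (A.historyProb_nonneg ω I h)
  refine le_trans (le_of_eq ?_) this
  simp_rw [mul_sub]
  rw [Finset.sum_sub_distrib, ← Finset.sum_mul, A.sum_historyProb ω I hD, Finset.mul_sum, one_mul]
  congr 1
  exact Finset.sum_congr rfl fun h _ => by ring

section Hub

open Problem

variable {w : Fin D → Fin K} {θ θ' : Fin D → Fin K → ℝ} {hθ₀ : ∀ d i, 0 ≤ θ d i}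
  {hθ : ∀ d i, θ d i < 1 / 2} {hθ₀' : ∀ d i, 0 ≤ θ' d i} {hθ' : ∀ d i, θ' d i < 1 / 2}

/-- Two instances that differ for one user and one arm can only be told apart by playing the
Condorcet winner of that user. -/
theorem sum_abs_historyProb_sub_le (u : Fin D) (s : Fin K) (hs : s ≠ w u)
    (hne : ∀ d i, ¬(d = u ∧ i = s) → θ' d i = θ d i) (hx : 0 < θ u s) (hx' : 0 < θ' u s) :
    ∑ h : Fin T → Round D K, |A.historyProb (hub w θ hθ₀ hθ) ω h -
        A.historyProb (hub w θ' hθ₀' hθ') ω h| ≤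
      8 * ((θ u s - θ' u s) ^ 2 / (θ' u s * (1 - θ' u s)) *
        ∑ h : Fin T → Round D K, A.historyProb (hub w θ hθ₀ hθ) ω h * A.mass ω h (w u)) +
        1 / 8 := by
  have hD : 0 < D := u.pos
  have h1 := sum_abs_trajProb_sub_le
    (r := fun t h => (hub w θ hθ₀ hθ).roundProb (A.policy₁ t h ω) (A.policy₂ t h ω))
    (r' := fun t h => (hub w θ' hθ₀' hθ').roundProb (A.policy₁ t h ω) (A.policy₂ t h ω))
    (fun _ _ _ => roundProb_nonneg _ _ _ _) (fun _ _ => sum_roundProb _ hD _ _)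
    (fun _ _ => sum_roundProb _ hD _ _)
    (fun o => hubLogRatio (w u) s (θ u s) (θ' u s) o.1 o.2.1 (o.2.2 u))
    (fun _ _ o => roundProb_hub_eq u s hs hne hx hx' _ _ o) T
  -- Chain rule for relative entropy. The expectation is under the first instance, so a single set
  -- of masses will control all the perturbations.
  have h2 := sum_trajProb_mul_sum_le
    (r := fun t h => (hub w θ hθ₀ hθ).roundProb (A.policy₁ t h ω) (A.policy₂ t h ω))
    (fun _ _ _ => roundProb_nonneg _ _ _ _) (fun _ _ => sum_roundProb _ hD _ _)
    (fun o => hubLogRatio (w u) s (θ u s) (θ' u s) o.1 o.2.1 (o.2.2 u)) _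
    (fun t h => sum_roundProb_hub_mul_le u s hs hx hx' (hθ' u s) (A.policy₁ t h ω)
      (A.policy₂ t h ω)) T
  refine h1.trans ?_
  gcongr
  refine h2.trans (le_of_eq ?_)
  rw [Finset.mul_sum]
  refine Finset.sum_congr rfl fun h _ => ?_
  rw [← Finset.mul_sum]
  rw [mul_left_comm]
  rfl

end Hub

theorem sum_historyProb_mul_ge {I I' : Problem D K} {F : (Fin T → Round D K) → ℝ} {M V : ℝ}
    (hF₀ : ∀ h, 0 ≤ F h) (hF : ∀ h, F h ≤ M) (hM : 0 ≤ M)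
    (hV : ∑ h : Fin T → Round D K, |A.historyProb I ω h - A.historyProb I' ω h| ≤ V) :
    ∑ h, A.historyProb I ω h * F h - M * V ≤ ∑ h, A.historyProb I' ω h * F h := by
  have h1 : ∀ h : Fin T → Round D K, A.historyProb I ω h * F h - A.historyProb I' ω h * F h ≤
      M * |A.historyProb I ω h - A.historyProb I' ω h| := by
    intro h
    rw [← sub_mul, mul_comm M]
    exact (mul_le_mul_of_nonneg_right (le_abs_self _) (hF₀ h)).trans
      (mul_le_mul_of_nonneg_left (hF h) (abs_nonneg _))
  have h2 := Finset.sum_le_sum fun h (_ : h ∈ Finset.univ) => h1 h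
  rw [Finset.sum_sub_distrib, ← Finset.mul_sum] at h2
  linarith [mul_le_mul_of_nonneg_left hV hM]

/-! ### Integrability in the seed -/

section Integrability

/-- Measurable and bounded real functions. -/
def BddMeasurable (f : Ω → ℝ) : Prop := Measurable f ∧ ∃ C, ∀ ω, |f ω| ≤ C

theorem BddMeasurable.const (c : ℝ) : BddMeasurable fun _ : Ω => c :=
  ⟨measurable_const, |c|, fun _ => le_rfl⟩

theorem BddMeasurable.add {f g : Ω → ℝ} (hf : BddMeasurable f) (hg : BddMeasurable g) :
    BddMeasurable fun ω => f ω + g ω := by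
  obtain ⟨hf, C, hC⟩ := hf
  obtain ⟨hg, C', hC'⟩ := hg
  exact ⟨hf.add hg, C + C', fun ω => (abs_add_le _ _).trans (add_le_add (hC ω) (hC' ω))⟩

theorem BddMeasurable.mul {f g : Ω → ℝ} (hf : BddMeasurable f) (hg : BddMeasurable g) :
    BddMeasurable fun ω => f ω * g ω := by
  obtain ⟨hf, C, hC⟩ := hf
  obtain ⟨hg, C', hC'⟩ := hg
  refine ⟨hf.mul hg, C * C', fun ω => ?_⟩
  rw [abs_mul]
  exact mul_le_mul (hC ω) (hC' ω) (abs_nonneg _) ((abs_nonneg _).trans (hC ω))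

theorem BddMeasurable.sum {ι : Type*} (s : Finset ι) {f : ι → Ω → ℝ}
    (hf : ∀ i, BddMeasurable (f i)) : BddMeasurable fun ω => ∑ i ∈ s, f i ω := by
  classical
  induction s using Finset.induction_on with
  | empty => simpa using BddMeasurable.const 0
  | insert i s hi ih =>
    simp_rw [Finset.sum_insert hi]
    exact (hf i).add ih

theorem BddMeasurable.prod {ι : Type*} (s : Finset ι) {f : ι → Ω → ℝ}
    (hf : ∀ i, BddMeasurable (f i)) : BddMeasurable fun ω => ∏ i ∈ s, f i ω := by
  classical
  induction s using Finset.induction_on with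
  | empty => simpa using BddMeasurable.const 1
  | insert i s hi ih =>
    simp_rw [Finset.prod_insert hi]
    exact (hf i).mul ih

theorem BddMeasurable.integrable {f : Ω → ℝ} (hf : BddMeasurable f) (μ : Measure Ω)
    [IsFiniteMeasure μ] : Integrable f μ := by
  obtain ⟨hf, C, hC⟩ := hf
  exact Integrable.of_bound hf.aestronglyMeasurable C (Filter.Eventually.of_forall hC)

theorem bddMeasurable_policy {p : Ω → Policy K} (hp : Measurable p) (i : Fin K) :
    BddMeasurable fun ω => (p ω : Fin K → ℝ) i := by
  refine ⟨(measurable_pi_apply i).comp (measurable_subtype_coe.comp hp), 1, fun ω => ?_⟩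
  have h0 : 0 ≤ (p ω : Fin K → ℝ) i := (p ω).2.1 i
  rw [abs_of_nonneg h0]
  simpa only [Finset.sum_singleton] using Problem.sum_policy_le_one (p ω) {i}

theorem bddMeasurable_nsw (I : Problem D K) {p : Ω → Policy K} (hp : Measurable p) :
    BddMeasurable fun ω => I.nsw (p ω) :=
  BddMeasurable.prod _ fun _ => BddMeasurable.sum _ fun i =>
    (bddMeasurable_policy hp i).mul (BddMeasurable.const _)

theorem integrable_seedRegret (I : Problem D K) (T : ℕ) :
    Integrable (A.seedRegret I T) A.seedLaw := by
  have := A.isProbabilityMeasure_seedLaw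
  refine BddMeasurable.integrable (BddMeasurable.sum _ fun h => BddMeasurable.mul ?_ ?_) _
  · exact BddMeasurable.prod _ fun t => ((bddMeasurable_policy (A.measurable_policy₁ _ _) _).mul
      (bddMeasurable_policy (A.measurable_policy₂ _ _) _)).mul (BddMeasurable.const _)
  · have e : A.regret I (T := T) = fun ω h => ∑ t : Fin T, (I.optNsw +
        (-1 / 2) * (I.nsw (A.policy₁ t (past h t) ω) + I.nsw (A.policy₂ t (past h t) ω))) := by
      funext ω h
      exact Finset.sum_congr rfl fun t _ => by ring
    rw [e]
    exact BddMeasurable.sum _ fun t => (BddMeasurable.const _).add ((BddMeasurable.const _).mul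
      ((bddMeasurable_nsw I (A.measurable_policy₁ _ _)).add
        (bddMeasurable_nsw I (A.measurable_policy₂ _ _))))

end Integrability

end OnlineAlgorithm

/-! ### The hard instances and the averaging argument -/

open Problem

/-- The perturbation by `ε` for the user `u` and the arm `s`. -/
noncomputable def bump {D K : ℕ} (u : Fin D) (s : Fin K) (ε : ℝ) (d : Fin D) (i : Fin K) : ℝ :=
  if d = u ∧ i = s then ε else 0

theorem bump_nonneg {D K : ℕ} (u : Fin D) (s : Fin K) {ε : ℝ} (hε : 0 ≤ ε) (d : Fin D)
    (i : Fin K) : 0 ≤ bump u s ε d i := by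
  unfold bump; split_ifs <;> linarith

theorem bump_le {D K : ℕ} (u : Fin D) (s : Fin K) {ε : ℝ} (hε : ε ≤ 1 / 8) (d : Fin D)
    (i : Fin K) : bump u s ε d i ≤ 1 / 8 := by
  unfold bump; split_ifs <;> linarith

/-- The hard instances: the arm `s` is worse by `ε` for the user `u`. -/
noncomputable def bumped {D K : ℕ} (w : Fin D → Fin K) (a b : Fin K) {δ ε : ℝ} (hδ : 0 < δ)
    (hδ' : δ ≤ 1 / 8) (hε : 0 ≤ ε) (hε' : ε ≤ 1 / 8) (u : Fin D) (s : Fin K) : Problem D K :=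
  twoArm w a b δ (bump u s ε) hδ hδ' (bump_nonneg u s hε) (bump_le u s hε')

/-- The instance without perturbation. -/
noncomputable def unbumped {D K : ℕ} (w : Fin D → Fin K) (a b : Fin K) {δ : ℝ} (hδ : 0 < δ)
    (hδ' : δ ≤ 1 / 8) : Problem D K :=
  twoArm w a b δ (fun _ _ => 0) hδ hδ' (fun _ _ => le_rfl) (fun _ _ => by norm_num)

namespace OnlineAlgorithm

variable {D K : ℕ} {Ω : Type*} [MeasurableSpace Ω] (A : OnlineAlgorithm D K Ω) (T : ℕ) (ω : Ω)
  {w : Fin D → Fin K} {a b : Fin K} {δ ε : ℝ} (hδ : 0 < δ) (hδ' : δ ≤ 1 / 8) (hε : 0 ≤ ε)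
  (hε' : ε ≤ 1 / 8)

theorem seedRegret_unbumped_ge (hab : a ≠ b) (d₁ d₂ : Fin D) (hw : w d₁ ≠ w d₂)
    (ha : ∀ d, a ≠ w d) (hb : ∀ d, b ≠ w d) :
    3 / 8 * (2 * T - ∑ h : Fin T → Round D K,
        A.historyProb (unbumped w a b hδ hδ') ω h * A.mass ω h a -
      ∑ h : Fin T → Round D K, A.historyProb (unbumped w a b hδ hδ') ω h * A.mass ω h b) -
      2 * δ * D * T ≤ A.seedRegret (unbumped w a b hδ hδ') T ω := by
  have : NeZero K := ⟨a.pos.ne'⟩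
  have hD : 0 < D := d₁.pos
  have h1 := A.seedRegret_ge ω hD (A.regret_ge_of_two_arms (T := T) ω
    (optNsw_twoArm_ge (w := w) (a := a) (b := b) (hδ := hδ) (hδ' := hδ')
      (e := fun _ _ => 0) (he := fun _ _ => le_rfl) (he' := fun _ _ => by norm_num) a (Or.inl rfl)
      fun _ => rfl) (nsw_twoArm_le hab d₁ d₂ hw (ha _) (hb _) (ha _) (hb _)))
  refine le_trans (le_of_eq ?_) h1
  simp_rw [mul_sub]
  rw [Finset.sum_sub_distrib, Finset.sum_sub_distrib, ← Finset.sum_mul, sum_historyProb _ _ _ hD]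
  unfold unbumped
  ring

/-- Weight on the defective arm costs `ε` per unit, and its expectation is transferred from the
unperturbed instance. Since the mass is at most 2T, this loses at most 2T times the total variation
bound, where 48 = 8 · 6. -/
theorem seedRegret_bumped_ge (hab : a ≠ b) (u : Fin D) (ha : a ≠ w u) (hb : b ≠ w u)
    (s : Fin K) (hs : s = a ∨ s = b) :
    ε * (∑ h : Fin T → Round D K, A.historyProb (unbumped w a b hδ hδ') ω h * A.mass ω h s -
      2 * T * (48 * ε ^ 2 * ∑ h : Fin T → Round D K,
        A.historyProb (unbumped w a b hδ hδ') ω h * A.mass ω h (w u) + 1 / 8)) -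
      2 * δ * D * T ≤ A.seedRegret (bumped w a b hδ hδ' hε hε' u s) T ω := by
  have : NeZero K := ⟨a.pos.ne'⟩
  have hD : 0 < D := u.pos
  have hsw : s ≠ w u := by rcases hs with rfl | rfl <;> assumption
  -- The other good arm has no defect and keeps the optimum close to 1.
  have hopt : 1 - 2 * δ * D ≤ (bumped w a b hδ hδ' hε hε' u s).optNsw := by
    rcases hs with rfl | rfl
    · exact optNsw_twoArm_ge b (Or.inr rfl) fun d => if_neg fun h => hab h.2.symm
    · exact optNsw_twoArm_ge a (Or.inl rfl) fun d => if_neg fun h => hab h.2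
  have hbump : bump u s ε u s = ε := if_pos ⟨rfl, rfl⟩
  have hnsw : ∀ π : Policy K, (bumped w a b hδ hδ' hε hε' u s).nsw π ≤
      1 - 2 * ε * (π : Fin K → ℝ) s := by
    intro π
    have := nsw_twoArm_le_of_perturbed (w := w) (a := a) (b := b) (hδ := hδ) (hδ' := hδ')
      (he := bump_nonneg u s hε) (he' := bump_le u s hε') u s hs hsw π
    rwa [hbump] at this
  have h1 := A.seedRegret_ge ω hD (A.regret_ge_of_arm (T := T) ω hopt hnsw)
  refine le_trans (sub_le_sub_right (mul_le_mul_of_nonneg_left ?_ hε) _) h1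
  refine A.sum_historyProb_mul_ge ω (fun h => A.mass_nonneg ω h s) (fun h => A.mass_le ω h s)
    (by positivity) ?_
  have hθ : halfScore a b δ (fun _ _ => 0) u s = 1 / 2 - δ := by
    rw [halfScore, if_pos hs, sub_zero]
  have hθ' : halfScore a b δ (bump u s ε) u s = 1 / 2 - δ - ε := by
    rw [halfScore, if_pos hs, hbump]
  refine (A.sum_abs_historyProb_sub_le (θ := halfScore a b δ fun _ _ => 0)
    (θ' := halfScore a b δ (bump u s ε))
    (hθ₀ := halfScore_nonneg a b hδ' fun _ _ => by norm_num)
    (hθ := halfScore_lt a b hδ fun _ _ => le_rfl)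
    (hθ₀' := halfScore_nonneg a b hδ' (bump_le u s hε'))
    (hθ' := halfScore_lt a b hδ (bump_nonneg u s hε)) ω u s hsw ?_ ?_ ?_).trans ?_
  · intro d i hdi
    simp only [halfScore, bump, if_neg hdi]
  · rw [hθ]; linarith
  · rw [hθ']; linarith
  · rw [hθ, hθ']
    have hQ : 0 ≤ ∑ h : Fin T → Round D K,
        A.historyProb (unbumped w a b hδ hδ') ω h * A.mass ω h (w u) :=
      Finset.sum_nonneg fun h _ => mul_nonneg (A.historyProb_nonneg ω _ h) (A.mass_nonneg ω h _)
    -- Since δ + ε ≤ 1/4, the new parameter is in [1/4, 1/2], so its variance is at least 3/16, and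
    -- 16/3 ≤ 6.
    have hC : (1 / 2 - δ - (1 / 2 - δ - ε)) ^ 2 / ((1 / 2 - δ - ε) * (1 - (1 / 2 - δ - ε))) ≤
        6 * ε ^ 2 := by
      rw [div_le_iff₀ (mul_pos (by linarith) (by linarith))]
      have : 3 / 16 ≤ (1 / 2 - δ - ε) * (1 - (1 / 2 - δ - ε)) := by nlinarith
      nlinarith [mul_le_mul_of_nonneg_left this (sq_nonneg ε), sq_nonneg ε]
    have := mul_le_mul_of_nonneg_right hC hQ
    unfold unbumped twoArm at this ⊢
    linarith

/-- The regrets on the hard instances cannot all be small, whatever the seed is. -/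
theorem sum_seedRegret_ge {n : ℕ} (hn : 2 ≤ n) (hab : a ≠ b) (ha : ∀ d, a ≠ w d)
    (hb : ∀ d, b ≠ w d) (u : Fin n → Fin D) (hu : Function.Injective fun j => w (u j))
    (hεn : 512 * T * ε ^ 3 ≤ n) :
    n * (3 / 2 * ε * T - 8 * δ * D * T) ≤
      2 * n * A.seedRegret (unbumped w a b hδ hδ') T ω +
        ∑ j, (A.seedRegret (bumped w a b hδ hδ' hε hε' (u j) a) T ω +
          A.seedRegret (bumped w a b hδ hδ' hε hε' (u j) b) T ω) := by
  have hD : 0 < D := (u ⟨0, by omega⟩).pos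
  have hbase := A.seedRegret_unbumped_ge T ω hδ hδ' hab (u ⟨0, by omega⟩) (u ⟨1, by omega⟩)
    (fun h => by simpa using hu h) ha hb
  have hbump := fun j s => A.seedRegret_bumped_ge T ω hδ hδ' hε hε' hab (u j) (ha (u j))
    (hb (u j)) s
  set Q : Fin K → ℝ := fun i =>
    ∑ h : Fin T → Round D K, A.historyProb (unbumped w a b hδ hδ') ω h * A.mass ω h i with hQ
  -- The winners `w (u j)` are distinct and differ from a and b, so all these masses share one
  -- budget of 2T.
  have hQle : Q a + Q b + ∑ j, Q (w (u j)) ≤ 2 * T := by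
    have e : Q a + Q b + ∑ j, Q (w (u j)) = ∑ h : Fin T → Round D K,
        A.historyProb (unbumped w a b hδ hδ') ω h *
          (A.mass ω h a + A.mass ω h b + ∑ j, A.mass ω h (w (u j))) := by
      simp only [hQ, mul_add, Finset.sum_add_distrib, Finset.mul_sum]
      rw [Finset.sum_comm]
    rw [e]
    have h1 : ∀ h : Fin T → Round D K,
        A.mass ω h a + A.mass ω h b + ∑ j, A.mass ω h (w (u j)) ≤ 2 * T := by
      intro h
      have := A.sum_mass_le ω h (insert a (insert b (Finset.univ.image fun j => w (u j))))
      rw [Finset.sum_insert (by simp [hab, fun j => (ha (u j)).symm]),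
        Finset.sum_insert (by simp [fun j => (hb (u j)).symm]),
        Finset.sum_image fun _ _ _ _ h => hu h] at this
      linarith
    refine (Finset.sum_le_sum fun h _ => mul_le_mul_of_nonneg_left (h1 h)
      (A.historyProb_nonneg ω _ h)).trans (le_of_eq ?_)
    rw [← Finset.sum_mul, A.sum_historyProb ω _ hD, one_mul]
  have hQ0 : 0 ≤ ∑ j, Q (w (u j)) := Finset.sum_nonneg fun j _ => Finset.sum_nonneg fun h _ =>
    mul_nonneg (A.historyProb_nonneg ω _ h) (A.mass_nonneg ω h _)
  have hsum := Finset.sum_le_sum fun j (_ : j ∈ Finset.univ) =>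
    add_le_add (hbump j a (Or.inl rfl)) (hbump j b (Or.inr rfl))
  have e : ∑ j : Fin n, ((ε * (Q a - 2 * T * (48 * ε ^ 2 * Q (w (u j)) + 1 / 8)) - 2 * δ * D * T) +
      (ε * (Q b - 2 * T * (48 * ε ^ 2 * Q (w (u j)) + 1 / 8)) - 2 * δ * D * T)) =
      n * (ε * (Q a + Q b - T / 2) - 4 * δ * D * T) -
        192 * T * ε ^ 3 * ∑ j, Q (w (u j)) := by
    have : ∀ j : Fin n, ((ε * (Q a - 2 * T * (48 * ε ^ 2 * Q (w (u j)) + 1 / 8)) -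
        2 * δ * D * T) + (ε * (Q b - 2 * T * (48 * ε ^ 2 * Q (w (u j)) + 1 / 8)) -
        2 * δ * D * T)) = (ε * (Q a + Q b - T / 2) - 4 * δ * D * T) -
        192 * T * ε ^ 3 * Q (w (u j)) := fun j => by ring
    simp_rw [this]
    rw [Finset.sum_sub_distrib, ← Finset.mul_sum, Finset.sum_const, Finset.card_univ,
      Fintype.card_fin, nsmul_eq_mul]
  change ∑ j : Fin n, ((ε * (Q a - 2 * T * (48 * ε ^ 2 * Q (w (u j)) + 1 / 8)) - 2 * δ * D * T) +
      (ε * (Q b - 2 * T * (48 * ε ^ 2 * Q (w (u j)) + 1 / 8)) - 2 * δ * D * T)) ≤ _ at hsum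
  rw [e] at hsum
  have hn0 : (0 : ℝ) ≤ n := n.cast_nonneg
  have h1 := mul_le_mul_of_nonneg_left hbase (mul_nonneg zero_le_two hn0)
  change 2 * (n : ℝ) * (3 / 8 * (2 * T - Q a - Q b) - 2 * δ * D * T) ≤ _ at h1
  have hM : 0 ≤ 2 * T - Q a - Q b := by linarith
  -- The base regret, taken 2n times, provides 3/4 · n(2T - Q a - Q b). Of this, 3/8 pays for the
  -- information (192 = 512 · 3/8), and 1/8 pays for replacing Q a + Q b by 2T in the defective
  -- instances.
  have h2 : 192 * T * ε ^ 3 * ∑ j, Q (w (u j)) ≤ 3 / 8 * n * (2 * T - Q a - Q b) :=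
    mul_le_mul (by linarith) (by linarith) hQ0 (by positivity)
  have h3 : n * (ε * (2 * T - Q a - Q b)) ≤ n * (1 / 8 * (2 * T - Q a - Q b)) :=
    mul_le_mul_of_nonneg_left (mul_le_mul_of_nonneg_right hε' hM) hn0
  have h4 : 0 ≤ n * (2 * T - Q a - Q b) := mul_nonneg hn0 hM
  refine le_trans ?_ (add_le_add h1 hsum)
  linarith

theorem exists_expectedRegret_ge {n : ℕ} (hn : 2 ≤ n) (hab : a ≠ b) (ha : ∀ d, a ≠ w d)
    (hb : ∀ d, b ≠ w d) (u : Fin n → Fin D) (hu : Function.Injective fun j => w (u j))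
    (hδ : 0 < δ) (hδ' : δ ≤ 1 / 8) (hε : 0 ≤ ε) (hε' : ε ≤ 1 / 8)
    (hεn : 512 * T * ε ^ 3 ≤ n) (hδε : 16 * δ * D * T ≤ ε * T) :
    ∃ I : Problem D K, ε * T / 4 ≤ A.expectedRegret I T := by
  by_contra! hlt
  have := A.isProbabilityMeasure_seedLaw
  have hint := fun I => A.integrable_seedRegret I T
  have hsum : Integrable (fun ω => ∑ j, (A.seedRegret (bumped w a b hδ hδ' hε hε' (u j) a) T ω +
      A.seedRegret (bumped w a b hδ hδ' hε hε' (u j) b) T ω)) A.seedLaw :=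
    integrable_finsetSum _ fun j _ => (hint _).add (hint _)
  have h1 := integral_mono (μ := A.seedLaw) (integrable_const _)
    (((hint (unbumped w a b hδ hδ')).const_mul (2 * (n : ℝ))).add hsum)
    fun ω => A.sum_seedRegret_ge T ω hδ hδ' hε hε' hn hab ha hb u hu hεn
  have e : ∫ ω, (((fun ω => 2 * (n : ℝ) * A.seedRegret (unbumped w a b hδ hδ') T ω) +
      fun ω => ∑ j, (A.seedRegret (bumped w a b hδ hδ' hε hε' (u j) a) T ω +
      A.seedRegret (bumped w a b hδ hδ' hε hε' (u j) b) T ω)) ω) ∂A.seedLaw =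
      2 * n * A.expectedRegret (unbumped w a b hδ hδ') T +
      ∑ j, (A.expectedRegret (bumped w a b hδ hδ' hε hε' (u j) a) T +
        A.expectedRegret (bumped w a b hδ hδ' hε hε' (u j) b) T) := by
    rw [integral_add' ((hint _).const_mul _) hsum, integral_const_mul]
    congr 1
    refine (integral_finsetSum _ fun j _ => (hint _).add (hint _)).trans ?_
    exact Finset.sum_congr rfl fun j _ => integral_add (hint _) (hint _)
  rw [e, integral_const, probReal_univ, one_smul] at h1
  have hn0 : (0 : ℝ) < n := by exact_mod_cast (by omega : 0 < n)
  -- The weights total 4n, so the weighted sum would be below n ε T. But 8 δ D T ≤ ε T / 2 leaves at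
  -- least n ε T.
  have h2 := mul_lt_mul_of_pos_left (hlt (unbumped w a b hδ hδ')) (mul_pos zero_lt_two hn0)
  have h3 : ∑ j, (A.expectedRegret (bumped w a b hδ hδ' hε hε' (u j) a) T +
      A.expectedRegret (bumped w a b hδ hδ' hε hε' (u j) b) T) ≤ n * (ε * T / 4 + ε * T / 4) := by
    refine (Finset.sum_le_sum fun j _ => add_le_add (hlt _).le (hlt _).le).trans (le_of_eq ?_)
    rw [Finset.sum_const, Finset.card_univ, Fintype.card_fin, nsmul_eq_mul]
  have h4 := mul_le_mul_of_nonneg_left hδε hn0.le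
  linarith

end OnlineAlgorithm

end FairDueling

/-- There is a universal constant `c > 0` such that, for all `D, K ≥ 4` and every horizon
`T ≥ min K D`, every online algorithm (which may know `D`, `K` and `T`) suffers on some instance
an expected regret of at least `c * T ^ (2/3) * (min K D) ^ (1/3)`. -/
theorem theorem1 :
    ∃ c : ℝ, 0 < c ∧
      ∀ (D K T : ℕ), 4 ≤ D → 4 ≤ K → min K D ≤ T →
        ∀ (Ω : Type*) [MeasurableSpace Ω] (A : FairDueling.OnlineAlgorithm D K Ω),
          ∃ I : FairDueling.Problem D K,
            c * (T : ℝ) ^ (2 / 3 : ℝ) * ((min K D : ℕ) : ℝ) ^ (1 / 3 : ℝ) ≤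
              A.expectedRegret I T := by
  refine ⟨1 / 64, by norm_num, fun D K T hD hK hT Ω _ A => ?_⟩
  -- Two arms are reserved for a and b.
  obtain ⟨n, hn⟩ : ∃ n, min K D = n + 2 := ⟨min K D - 2, by omega⟩
  have hnK : n + 2 ≤ K := hn ▸ min_le_left _ _
  have hnD : n + 2 ≤ D := hn ▸ min_le_right _ _
  have hn2 : 2 ≤ n := by omega
  rw [hn] at hT ⊢
  have hT1 : (1 : ℝ) ≤ T := by exact_mod_cast (by omega : 1 ≤ T)
  have hn1 : (1 : ℝ) ≤ n := by exact_mod_cast (by omega : 1 ≤ n)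
  have hD1 : (1 : ℝ) ≤ D := by exact_mod_cast (by omega : 1 ≤ D)
  have hnT : (n : ℝ) ≤ T := by exact_mod_cast (by omega : n ≤ T)
  set r : ℝ := (n : ℝ) ^ (1 / 3 : ℝ) with hr
  set τ : ℝ := (T : ℝ) ^ (1 / 3 : ℝ) with hτ
  have hr3 : r ^ 3 = n := by
    rw [hr, ← Real.rpow_natCast, ← Real.rpow_mul n.cast_nonneg]; norm_num
  have hτ3 : τ ^ 3 = T := by
    rw [hτ, ← Real.rpow_natCast, ← Real.rpow_mul T.cast_nonneg]; norm_num
  have hτ2 : (T : ℝ) ^ (2 / 3 : ℝ) = τ ^ 2 := by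
    rw [hτ, ← Real.rpow_natCast, ← Real.rpow_mul T.cast_nonneg]; norm_num
  have hr1 : 1 ≤ r := Real.one_le_rpow hn1 (by norm_num)
  have hτ1 : 1 ≤ τ := Real.one_le_rpow hT1 (by norm_num)
  -- This is where the lower bound on T enters: it gives ε = r/(8τ) ≤ 1/8.
  have hrτ : r ≤ τ := Real.rpow_le_rpow n.cast_nonneg hnT (by norm_num)
  have hτ0 : 0 < τ := by linarith
  -- From n + 2 ≤ 8n. The bound ε T / 4 = r τ² / 32 then gives the constant 1/64.
  have hm : ((n + 2 : ℕ) : ℝ) ^ (1 / 3 : ℝ) ≤ 2 * r := by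
    have h8 : (2 : ℝ) = 8 ^ (1 / 3 : ℝ) := by
      rw [show (8 : ℝ) = 2 ^ (3 : ℝ) by norm_num, ← Real.rpow_mul (by norm_num)]; norm_num
    rw [hr, h8, ← Real.mul_rpow (by norm_num) n.cast_nonneg]
    refine Real.rpow_le_rpow (Nat.cast_nonneg _) ?_ (by norm_num)
    push_cast
    linarith
  have hεT : r / (8 * τ) * T = r * τ ^ 2 / 8 := by
    rw [← hτ3]; field_simp
  have hDT : (1 : ℝ) ≤ D * T := one_le_mul_of_one_le_of_one_le hD1 hT1
  have hrτ2 : 1 ≤ r * τ ^ 2 := one_le_mul_of_one_le_of_one_le hr1 (one_le_pow₀ hτ1)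
  have hdef : ∀ d : Fin D, (if (d : ℕ) < n then (d : ℕ) + 2 else 2) < K := fun d => by
    split_ifs <;> omega
  -- Users below n get the distinct winners 2, ..., n + 1; the rest share arm 2, which only has to
  -- avoid a and b. The value of ε gives 512 T ε³ = n exactly. The gap δ must be positive for
  -- winners to be strict, and is small enough that 16 δ D T = 1/8 ≤ ε T.
  obtain ⟨I, hI⟩ := A.exists_expectedRegret_ge T (n := n)
    (w := fun d => ⟨if (d : ℕ) < n then (d : ℕ) + 2 else 2, hdef d⟩)
    (a := ⟨0, by omega⟩) (b := ⟨1, by omega⟩) (δ := 1 / (128 * (D * T))) (ε := r / (8 * τ))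
    hn2 (by simp) (fun d h => by
      have := congrArg Fin.val h
      simp only at this
      split_ifs at this) (fun d h => by
      have := congrArg Fin.val h
      simp only at this
      split_ifs at this <;> omega)
    (fun j => ⟨j, by omega⟩) (fun i j h => by
      have := congrArg Fin.val h
      simp only [i.isLt, j.isLt, if_true] at this
      exact Fin.ext (by omega))
    (by positivity) (by rw [div_le_div_iff₀ (by positivity) (by norm_num)]; linarith)
    (by positivity) (by rw [div_le_div_iff₀ (by positivity) (by norm_num)]; linarith)
    (by
      rw [div_pow, ← hr3, ← hτ3]
      refine le_of_eq ?_
      field_simp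
      norm_num)
    (by
      rw [hεT]
      have : 16 * (1 / (128 * ((D : ℝ) * T))) * D * T = 1 / 8 := by
        field_simp
        norm_num
      rw [this]
      linarith)
  refine ⟨I, le_trans ?_ hI⟩
  rw [hεT, hτ2]
  have := mul_le_mul_of_nonneg_left hm (sq_nonneg τ)
  linarith
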